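/- Let $N\ge 2$ and let $f:\mathbb Z^N\to\mathbb R$ have finite support. Let $\Delta_N f(\mathbf n)=\sum_{k=1}^N\big[f(\mathbf n+\mathbf e_k)+f(\mathbf n-\mathbf e_k)-2f(\mathbf n)\big]$ be the discrete Laplacian on $\mathbb Z^N$, let $e^{t\Delta_N}f=\sum_{j\ge0}\frac{t^j}{j!}\Delta_N^jf$ be the heat semigroup, put $(-\Delta_N)^0f=f$, and for $0<s<1$ $$(-\Delta_N)^sf(\mathbf n)=\frac1{\Gamma(-s)}\int_0^\infty\big(e^{t\Delta_N}f(\mathbf n)-f(\mathbf n)\big)\frac{dt}{t^{s+1}}.$$ Let $I_k(x)=\sum_{j\ge0}\frac{(x/2)^{2j+|k|}}{j!\,(j+|k|)!}$ $(k\in\mathbb Z)$ be the modified Bessel function of the first kind, and for $\mathbf m=(m_1,\dots,m_N)\in\mathbb Z^N$ let $$G_{t,N}(\mathbf m)=\prod_{k=1}^N e^{-2t}I_{m_k}(2t),\qquad K(\mathbf m)=\int_0^\infty G_{t,N}(\mathbf m)\,\frac{dt}{t}\quad(\mathbf m\ne\mathbf 0),\qquad K(\mathbf 0)=0,$$ $$\rho_N=\sum_{\mathbf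 m\ne\mathbf 0}\int_0^1G_{t,N}(\mathbf m)\,\frac{dt}{t}-\int_1^\infty G_{t,N}(\mathbf 0)\,\frac{dt}{t}-\gamma,$$ where $\gamma$ is Euler's constant. Then the integrals and series defining $e^{t\Delta_N}f(\mathbf n)$ $(t\in\mathbb R)$, $(-\Delta_N)^sf(\mathbf n)$ $(0<s<1)$, $K$ and $\rho_N$ converge absolutely. For every $\mathbf n\in\mathbb Z^N$ the right derivative $$\log(-\Delta_N)f(\mathbf n):=\frac{d}{ds}(-\Delta_N)^sf(\mathbf n)\Big|_{s=0^+}$$ exists, and $$\log(-\Delta_N)f(\mathbf n)=-\sum_{\mathbf m\in\mathbb Z^N,\ \mathbf m\neq\mathbf n}K(\mathbf n-\mathbf m)f(\mathbf m)+\rho_Nf(\mathbf n).$$ Moreover, $\log(-\Delta_N)f\in\ell^\infty(\mathbb Z^N)$ and $$\lim_{s\to0^+}\Big\|\frac{(-\Delta_N)^sf-f}{s}-\log(-\Delta_N)f\Big\|_{\ell^\infty(\mathbb Z^N)}=0.$$ -/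

import Mathlib

open Set Filter Topology MeasureTheory
open scoped ENNReal Nat

noncomputable section

/-- The discrete Laplacian on `ℤ^N`:
`Δ_N f(n) = ∑_k (f(n + e_k) + f(n - e_k) - 2 f(n))`. -/
def discreteLaplacian {N : ℕ} (f : (Fin N → ℤ) → ℝ) (n : Fin N → ℤ) : ℝ :=
  ∑ k : Fin N, (f (n + Pi.single k 1) + f (n - Pi.single k 1) - 2 * f n)

/-- The `j`-th term of the exponential series of `t Δ_N`, applied to `f` at `n`:
`t^j / j! * (Δ_N)^j f(n)`. -/
def discreteHeatTerm {N : ℕ} (t : ℝ) (f : (Fin N → ℤ) → ℝ) (n : Fin N → ℤ) (j : ℕ) : ℝ :=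
  t ^ j / (j ! : ℝ) * (discreteLaplacian^[j] f) n

/-- The heat semigroup `e^{t Δ_N} f(n) = ∑_j t^j / j! * (Δ_N)^j f(n)`. Since `Δ_N` is a bounded
operator on `ℓ^∞(ℤ^N)`, for bounded `f` this is the bounded solution at time `t` of the
semidiscrete heat equation `∂_t u = Δ_N u`, `u(·, 0) = f`. -/
def discreteHeatSemigroup {N : ℕ} (t : ℝ) (f : (Fin N → ℤ) → ℝ) (n : Fin N → ℤ) : ℝ :=
  ∑' j : ℕ, discreteHeatTerm t f n j

/-- The integrand `(e^{t Δ_N} f(n) - f(n)) / t^{s+1}` of the heat semigroup formula for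
`(-Δ_N)^s f(n)`. -/
def fracLaplacianIntegrand {N : ℕ} (s : ℝ) (f : (Fin N → ℤ) → ℝ) (n : Fin N → ℤ) (t : ℝ) : ℝ :=
  (discreteHeatSemigroup t f n - f n) / t ^ (s + 1)

/-- The fractional power `(-Δ_N)^s` for `0 ≤ s < 1`: the identity for `s = 0`, and for `0 < s < 1`
`(-Δ_N)^s f(n) = (1 / Γ(-s)) ∫_0^∞ (e^{t Δ_N} f(n) - f(n)) dt / t^{s+1}`. -/
def fracDiscreteLaplacian {N : ℕ} (s : ℝ) (f : (Fin N → ℤ) → ℝ) (n : Fin N → ℤ) : ℝ :=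
  if s = 0 then f n
  else 1 / Real.Gamma (-s) * ∫ t in Ioi (0 : ℝ), fracLaplacianIntegrand s f n t

/-- The logarithmic Laplacian `log(-Δ_N)`: the right derivative of `s ↦ (-Δ_N)^s` at `s = 0`. -/
def logDiscreteLaplacian {N : ℕ} (f : (Fin N → ℤ) → ℝ) (n : Fin N → ℤ) : ℝ :=
  derivWithin (fun s : ℝ => fracDiscreteLaplacian s f n) (Ioi 0) 0

/-- The modified Bessel function of the first kind of integer order `k` (recall `I_{-k} = I_k`):
`I_k(x) = ∑_j (x/2)^{2j+|k|} / (j! (j+|k|)!)`. -/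
def modifiedBesselI (k : ℤ) (x : ℝ) : ℝ :=
  ∑' j : ℕ, (x / 2) ^ (2 * j + k.natAbs) / ((j ! : ℝ) * ((j + k.natAbs)! : ℝ))

/-- The heat kernel `G_{t,N}(m) = ∏_k e^{-2t} I_{m_k}(2t)` on `ℤ^N`. -/
def discreteHeatKernel {N : ℕ} (t : ℝ) (m : Fin N → ℤ) : ℝ :=
  ∏ k : Fin N, Real.exp (-2 * t) * modifiedBesselI (m k) (2 * t)

/-- The kernel `K(m) = ∫_0^∞ G_{t,N}(m) dt / t` for `m ≠ 0`, and `K(0) = 0`. -/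
def logKernel {N : ℕ} (m : Fin N → ℤ) : ℝ :=
  if m = 0 then 0 else ∫ t in Ioi (0 : ℝ), discreteHeatKernel t m / t

/-- The corrector
`ρ_N = ∑_{m ≠ 0} ∫_0^1 G_{t,N}(m) dt / t - ∫_1^∞ G_{t,N}(0) dt / t - γ`. -/
def logCorrector (N : ℕ) : ℝ :=
  (∑' m : {m : Fin N → ℤ // m ≠ 0}, ∫ t in Ioc (0 : ℝ) 1, discreteHeatKernel t m.1 / t)
    - (∫ t in Ioi (1 : ℝ), discreteHeatKernel t (0 : Fin N → ℤ) / t)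
    - Real.eulerMascheroniConstant

end

/-! Write `g(s) = 1/Γ(1-s)`, so that `1/Γ(-s) = -s g(s)`. The heat semigroup is convolution with
`G_t`, so the integrand of `(-Δ)^s f(n)` is `∑ f(m) (G_t(n-m) - δ_{nm}) / t^{s+1}`. The point mass
is needed only to tame `t → 0`. Subtracting it for `t ≤ 1` alone gives a kernel `ψ_t`
(`regularizedKernel`), whose Mellin integral `M_s(a) = ∫ ψ_t(a) dt/t^{s+1}` converges for `0 ≤ s <
1`. The leftover tail is `-f(n) ∫_1^∞ dt/t^{s+1} = -f(n)/s`, a pole that the factor `-s` cancels.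
Hence `((-Δ)^s f(n) - f(n))/s = -g(s) ∑ f(m) M_s(n-m) + f(n) (g(s)-1)/s`
(`fracDiscreteLaplacian_sub_div`).

As `s → 0+`, `g(s) → 1`, `(g(s)-1)/s → g'(0) = -γ` and `M_s → M_0`. Off the origin `M_0 = K`; since
`G_t` has total mass one, `-M_0(0) - γ = ρ_N` (`logCorrector_eq`).

Uniformity in `n` comes from a bound on `|ψ_t(a)|` that is independent of `a`: `2Nt` for `t ≤ 1`,
because `1 - G_t(0) ≤ 1 - e^{-2Nt}`, and `t^{-1/2}` for `t > 1`, by Stirling's formula for Poisson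
weights. The error is then at most the `ℓ¹` norm of `f` times a quantity depending only on `N` and
`s` (`abs_quotient_sub_logLaplacianSum_le`), which tends to `0` by dominated convergence. -/

open scoped BoundedContinuousFunction

noncomputable section

/-! ### Bessel generating function and the one-dimensional heat kernel -/

/-- The bijection `(m, k) ↦ (k + m⁺, k + m⁻)`, with inverse `(i, j) ↦ (i - j, min i j)`. -/
def intProdNatEquiv : ℤ × ℕ ≃ ℕ × ℕ where
  toFun p := (p.2 + p.1.toNat, p.2 + (-p.1).toNat)
  invFun q := ((q.1 : ℤ) - q.2, min q.1 q.2)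
  left_inv := by
    rintro ⟨m, k⟩
    ext <;> simp
    omega
  right_inv := by rintro ⟨i, j⟩; ext <;> simp <;> omega

lemma summable_pow_div_factorial_mul (t : ℝ) (h : ℤ → ℝ) (C : ℝ) (hC : ∀ m, |h m| ≤ C) :
    Summable fun q : ℕ × ℕ =>
      t ^ q.1 / (q.1 ! : ℝ) * (t ^ q.2 / (q.2 ! : ℝ)) * h ((q.1 : ℤ) - q.2) := by
  have hs : Summable fun q : ℕ × ℕ =>
      ‖t ^ q.1 / (q.1 ! : ℝ) * (t ^ q.2 / (q.2 ! : ℝ))‖ := by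
    have := (Real.summable_pow_div_factorial t).norm
    exact (summable_mul_of_summable_norm this this).norm
  refine Summable.of_norm_bounded (hs.mul_right C) fun q => ?_
  rw [norm_mul]
  exact mul_le_mul_of_nonneg_left (hC _) (norm_nonneg _)

/-- One of `m⁺`, `m⁻` is `0` and the other is `|m|`, so the exponents add up to `2k + |m|`. The form
`2 * t / 2` matches the series of `modifiedBesselI m (2 * t)`. -/
lemma modifiedBesselI_term (t : ℝ) (m : ℤ) (k : ℕ) :
    t ^ (k + m.toNat) / ((k + m.toNat)! : ℝ) * (t ^ (k + (-m).toNat) / ((k + (-m).toNat)! : ℝ)) =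
      (2 * t / 2) ^ (2 * k + m.natAbs) / ((k ! : ℝ) * ((k + m.natAbs)! : ℝ)) := by
  rw [mul_div_cancel_left₀ t two_ne_zero, div_mul_div_comm, ← pow_add]
  rcases le_total 0 m with hm | hm
  · have h1 : m.toNat = m.natAbs := by omega
    have h2 : (-m).toNat = 0 := by omega
    rw [h1, h2]
    congr 1
    · congr 1; omega
    · rw [mul_comm]; simp
  · have h1 : (-m).toNat = m.natAbs := by omega
    have h2 : m.toNat = 0 := by omega
    rw [h1, h2]
    congr 1
    congr 1; omega

lemma summable_modifiedBesselI_term (t : ℝ) (m : ℤ) :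
    Summable fun k : ℕ =>
      (2 * t / 2) ^ (2 * k + m.natAbs) / ((k ! : ℝ) * ((k + m.natAbs)! : ℝ)) := by
  have h := (intProdNatEquiv.summable_iff.mpr
    (summable_pow_div_factorial_mul t (fun _ => 1) 1 (by simp))).prod_factor m
  refine h.congr fun k => ?_
  simp only [Function.comp, mul_one]
  exact modifiedBesselI_term t m k

/-- The generating function identity `e^{t z} e^{t / z} = ∑ I_m(2t) z^m`, tested against a bounded
function. -/
lemma hasSum_modifiedBesselI_mul (t : ℝ) (h : ℤ → ℝ) (C : ℝ) (hC : ∀ m, |h m| ≤ C) :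
    HasSum (fun m : ℤ => modifiedBesselI m (2 * t) * h m)
      (∑' q : ℕ × ℕ, t ^ q.1 / (q.1 ! : ℝ) * (t ^ q.2 / (q.2 ! : ℝ)) * h ((q.1 : ℤ) - q.2)) := by
  have h1 := intProdNatEquiv.hasSum_iff.mpr (summable_pow_div_factorial_mul t h C hC).hasSum
  refine h1.prod_fiberwise fun m => ?_
  refine ((summable_modifiedBesselI_term t m).hasSum.mul_right (h m)).congr_fun
    fun k => ?_
  rw [← modifiedBesselI_term]
  simp only [Function.comp, intProdNatEquiv, Equiv.coe_fn_mk]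
  congr 2
  push_cast
  omega

lemma modifiedBesselI_neg (m : ℤ) (x : ℝ) : modifiedBesselI (-m) x = modifiedBesselI m x := by
  simp [modifiedBesselI]

/-- The one-dimensional heat kernel `e^{-2t} I_m(2t)`. -/
def besselKernel (t : ℝ) (m : ℤ) : ℝ := Real.exp (-2 * t) * modifiedBesselI m (2 * t)

lemma discreteHeatKernel_eq {N : ℕ} (t : ℝ) (m : Fin N → ℤ) :
    discreteHeatKernel t m = ∏ k, besselKernel t (m k) := rfl

/-- Testing the generating function against the constant `1` gives `∑ I_m(2t) = e^t e^t`. -/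
lemma hasSum_besselKernel (t : ℝ) : HasSum (besselKernel t) 1 := by
  have h := hasSum_modifiedBesselI_mul t (fun _ => 1) 1 (by simp)
  have he : HasSum (fun n : ℕ => t ^ n / (n ! : ℝ)) (Real.exp t) := by
    rw [Real.exp_eq_exp_ℝ]; exact NormedSpace.expSeries_div_hasSum_exp t
  have hn := he.summable.norm
  have h2 := he.mul he (summable_mul_of_summable_norm hn hn)
  simp only [mul_one] at h
  rw [h2.tsum_eq] at h
  have h3 := h.mul_left (Real.exp (-2 * t))
  rwa [← Real.exp_add, ← Real.exp_add, show -2 * t + (t + t) = 0 by ring, Real.exp_zero] at h3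

lemma modifiedBesselI_nonneg {t : ℝ} (ht : 0 ≤ t) (m : ℤ) : 0 ≤ modifiedBesselI m (2 * t) :=
  tsum_nonneg fun j => by positivity

lemma besselKernel_nonneg {t : ℝ} (ht : 0 ≤ t) (m : ℤ) : 0 ≤ besselKernel t m :=
  mul_nonneg (Real.exp_pos _).le (modifiedBesselI_nonneg ht m)

lemma besselKernel_le_one {t : ℝ} (ht : 0 ≤ t) (m : ℤ) : besselKernel t m ≤ 1 :=
  le_hasSum (hasSum_besselKernel t) m fun k _ => besselKernel_nonneg ht k

lemma exp_le_besselKernel_zero {t : ℝ} (ht : 0 ≤ t) : Real.exp (-2 * t) ≤ besselKernel t 0 := by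
  refine le_mul_of_one_le_right (Real.exp_pos _).le ?_
  have h := (summable_modifiedBesselI_term t 0).le_tsum 0 fun j _ => by positivity
  simpa [modifiedBesselI] using h

lemma measurable_besselKernel (m : ℤ) : Measurable fun t => besselKernel t m := by
  refine (by fun_prop : Measurable fun t : ℝ => Real.exp (-2 * t)).mul ?_
  refine measurable_of_tendsto_metrizable (f := fun (n : ℕ) (t : ℝ) => ∑ k ∈ Finset.range n,
      (2 * t / 2) ^ (2 * k + m.natAbs) / ((k ! : ℝ) * ((k + m.natAbs)! : ℝ))) (fun n => ?_) ?_
  · fun_prop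
  · rw [tendsto_pi_nhds]
    intro t
    exact (summable_modifiedBesselI_term t m).hasSum.tendsto_sum_nat

/-! ### Decay of the one-dimensional kernel in time -/

/-- The Poisson weights are increasing up to the mean. -/
lemma poisson_weight_le_of_le {t : ℝ} (ht : 0 ≤ t) {j k : ℕ} (hjk : j ≤ k) (hk : (k : ℝ) ≤ t) :
    t ^ j / (j ! : ℝ) ≤ t ^ k / (k ! : ℝ) := by
  induction k, hjk using Nat.le_induction with
  | base => rfl
  | succ k hjk ih =>
    push_cast at hk
    refine (ih (by linarith)).trans ?_
    rw [pow_succ, Nat.factorial_succ, Nat.cast_mul, mul_comm (_ : ℝ) t, mul_div_mul_comm]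
    refine le_mul_of_one_le_left (by positivity) ?_
    rw [one_le_div (by positivity)]
    exact_mod_cast hk

/-- For fixed `j`, `t^j e^{-t}` is largest at `t = j`, as follows from `x ≤ e^{x-1}` with `x = t/j`;
Stirling's lower bound for `j!` does the rest. -/
lemma poisson_weight_le_stirling {t : ℝ} (ht : 0 < t) {j : ℕ} (hj : 0 < j) :
    Real.exp (-t) * (t ^ j / (j ! : ℝ)) ≤ 1 / √(2 * Real.pi * j) := by
  have hj' : (0 : ℝ) < j := by exact_mod_cast hj
  have hst := Stirling.le_factorial_stirling j
  have hpi := Real.pi_pos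
  have hsq : 0 < √(2 * Real.pi * j) := Real.sqrt_pos.mpr (by positivity)
  -- `t^j e^{-t} ≤ (j / e)^j`
  have h1 : Real.exp (-t) * t ^ j ≤ (j / Real.exp 1) ^ j := by
    have h2 : t / j ≤ Real.exp (t / j - 1) := by
      have := Real.add_one_le_exp (t / j - 1); linarith
    have h3 : (t / j) ^ j ≤ Real.exp (t - j) := by
      refine (pow_le_pow_left₀ (by positivity) h2 j).trans (le_of_eq ?_)
      rw [← Real.exp_nat_mul]
      congr 1; field_simp
    have h4 : t ^ j ≤ Real.exp (t - j) * j ^ j := by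
      rwa [div_pow, div_le_iff₀ (by positivity)] at h3
    calc Real.exp (-t) * t ^ j ≤ Real.exp (-t) * (Real.exp (t - j) * j ^ j) := by gcongr
      _ = (j / Real.exp 1) ^ j := by
        rw [← mul_assoc, ← Real.exp_add, div_pow, ← Real.exp_nat_mul, div_eq_mul_inv,
          ← Real.exp_neg]
        rw [show -t + (t - j) = -(j * 1 : ℝ) by ring, mul_comm]
  rw [← mul_div_assoc, div_le_div_iff₀ (by positivity) hsq, one_mul]
  calc _ ≤ (j / Real.exp 1) ^ j * √(2 * Real.pi * j) := by gcongr
    _ ≤ _ := by rwa [mul_comm]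

/-- For `j ≥ t/2` Stirling suffices, since `2πj ≥ t`. A smaller `j` lies below the mean, where
monotonicity allows a comparison with `⌊t⌋`. -/
lemma poisson_weight_le {t : ℝ} (ht : 1 ≤ t) (j : ℕ) :
    Real.exp (-t) * (t ^ j / (j ! : ℝ)) ≤ t ^ (-(1 / 2) : ℝ) := by
  have h0 : 0 < t := by linarith
  have key : ∀ j : ℕ, t / 2 ≤ j → Real.exp (-t) * (t ^ j / (j ! : ℝ)) ≤ t ^ (-(1 / 2) : ℝ) := by
    intro j hj
    have hj0 : 0 < j := by
      have : (0 : ℝ) < j := by linarith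
      exact_mod_cast this
    refine (poisson_weight_le_stirling h0 hj0).trans ?_
    rw [Real.rpow_neg h0.le, ← Real.sqrt_eq_rpow, one_div]
    gcongr
    nlinarith [Real.pi_gt_three]
  by_cases hj : t / 2 ≤ j
  · exact key j hj
  · have hfl := Nat.floor_le h0.le
    have hfl' := Nat.lt_floor_add_one t
    have h1 : (1 : ℝ) ≤ ⌊t⌋₊ := by exact_mod_cast Nat.le_floor (by simpa using ht)
    have hjk : j ≤ ⌊t⌋₊ := Nat.le_floor (by linarith)
    -- Adding `⌊t⌋ ≥ 1` and `⌊t⌋ > t - 1` gives `⌊t⌋ ≥ t/2`.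
    refine le_trans ?_ (key ⌊t⌋₊ (by linarith))
    gcongr ?_ * ?_
    exact poisson_weight_le_of_le h0.le hjk hfl

/-- Each term of `e^{-2t} I_m(2t)` is a product of the Poisson weights at `k + |m|` and `k`. The
first is bounded uniformly, and the second sums to one over `k`. -/
lemma besselKernel_le_rpow {t : ℝ} (ht : 1 ≤ t) (m : ℤ) :
    besselKernel t m ≤ t ^ (-(1 / 2) : ℝ) := by
  have h0 : 0 < t := by linarith
  have hs := (summable_modifiedBesselI_term t m).hasSum.mul_left (Real.exp (-2 * t))
  have he : HasSum (fun n : ℕ => t ^ n / (n ! : ℝ)) (Real.exp t) := by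
    rw [Real.exp_eq_exp_ℝ]; exact NormedSpace.expSeries_div_hasSum_exp t
  have he2 := (he.mul_left (Real.exp (-t))).mul_left (t ^ (-(1 / 2) : ℝ))
  rw [← Real.exp_add, neg_add_cancel, Real.exp_zero, mul_one] at he2
  refine hasSum_le (fun k => ?_) hs he2
  rw [mul_div_cancel_left₀ t two_ne_zero]
  have h1 := poisson_weight_le ht (k + m.natAbs)
  have h2 : Real.exp (-2 * t) * (t ^ (2 * k + m.natAbs) / ((k ! : ℝ) * ((k + m.natAbs)! : ℝ))) =
      (Real.exp (-t) * (t ^ (k + m.natAbs) / ((k + m.natAbs)! : ℝ))) *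
        (Real.exp (-t) * (t ^ k / (k ! : ℝ))) := by
    rw [show -2 * t = -t + -t by ring, Real.exp_add, show 2 * k + m.natAbs = k + m.natAbs + k by ring,
      pow_add]
    field_simp
  rw [h2]
  gcongr

/-! ### The heat semigroup as an operator exponential -/

/-- Translation by `v` as an operator on bounded functions on `ℤ^N`. -/
def translationCLM {N : ℕ} (v : Fin N → ℤ) :
    ((Fin N → ℤ) →ᵇ ℝ) →L[ℝ] ((Fin N → ℤ) →ᵇ ℝ) :=
  LinearMap.mkContinuous
    { toFun := fun g => g.compContinuous ⟨fun n => n + v, by fun_prop⟩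
      map_add' := fun g h => by ext; rfl
      map_smul' := fun c g => by ext; rfl } 1 fun g => by
    rw [one_mul]
    refine (BoundedContinuousFunction.norm_le (norm_nonneg _)).mpr fun n => ?_
    exact g.norm_coe_le_norm (n + v)

@[simp] lemma translationCLM_apply {N : ℕ} (v : Fin N → ℤ) (g : (Fin N → ℤ) →ᵇ ℝ)
    (n : Fin N → ℤ) : translationCLM v g n = g (n + v) := rfl

lemma translationCLM_mul {N : ℕ} (v w : Fin N → ℤ) :
    translationCLM v * translationCLM w = translationCLM (v + w) := by
  ext g n
  simp [add_assoc]

lemma translationCLM_zero {N : ℕ} : translationCLM (0 : Fin N → ℤ) = 1 := by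
  ext g n
  simp

lemma translationCLM_pow {N : ℕ} (v : Fin N → ℤ) (j : ℕ) :
    translationCLM v ^ j = translationCLM ((j : ℤ) • v) := by
  induction j with
  | zero => simp [translationCLM_zero]
  | succ j ih => rw [pow_succ, ih, translationCLM_mul]; congr 1; push_cast; rw [add_smul, one_smul]

lemma commute_translationCLM {N : ℕ} (v w : Fin N → ℤ) :
    Commute (translationCLM v) (translationCLM w) := by
  rw [commute_iff_eq, translationCLM_mul, translationCLM_mul, add_comm]

/-- The second difference in the `k`-th direction. -/
def secondDifferenceCLM {N : ℕ} (k : Fin N) : ((Fin N → ℤ) →ᵇ ℝ) →L[ℝ] ((Fin N → ℤ) →ᵇ ℝ) :=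
  translationCLM (Pi.single k 1) + translationCLM (-Pi.single k 1) - (2 : ℝ) • 1

lemma commute_smul_operators {E : Type*} [NormedAddCommGroup E] [NormedSpace ℝ E]
    {A B : E →L[ℝ] E} (h : Commute A B) (a b : ℝ) : Commute (a • A) (b • B) :=
  (h.smul_left a).smul_right b

lemma commute_symmetric_differences {E : Type*} [NormedAddCommGroup E] [NormedSpace ℝ E]
    {A A' B B' : E →L[ℝ] E} (h1 : Commute A B) (h2 : Commute A B') (h3 : Commute A' B)
    (h4 : Commute A' B') (c : ℝ) : Commute (A + A' - c • 1) (B + B' - c • 1) := by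
  have hone : ∀ {X : E →L[ℝ] E}, Commute X (c • 1) := fun {X} =>
    (Commute.one_right X).smul_right c
  have key : ∀ {X : E →L[ℝ] E}, Commute X B → Commute X B' → Commute X (B + B' - c • 1) :=
    fun hB hB' => (hB.add_right hB').sub_right hone
  exact ((key h1 h2).add_left (key h3 h4)).sub_left (key hone.symm hone.symm)

lemma smul_symmetric_difference {E : Type*} [NormedAddCommGroup E] [NormedSpace ℝ E]
    (A A' : E →L[ℝ] E) (t : ℝ) :
    t • (A + A' - (2 : ℝ) • 1) = (-2 * t) • 1 + (t • A + t • A') := by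
  module

lemma commute_secondDifferenceCLM {N : ℕ} (k l : Fin N) :
    Commute (secondDifferenceCLM k) (secondDifferenceCLM l) :=
  commute_symmetric_differences (commute_translationCLM _ _) (commute_translationCLM _ _)
    (commute_translationCLM _ _) (commute_translationCLM _ _) 2

/-- The discrete Laplacian on bounded functions. -/
def laplacianCLM (N : ℕ) : ((Fin N → ℤ) →ᵇ ℝ) →L[ℝ] ((Fin N → ℤ) →ᵇ ℝ) :=
  ∑ k, secondDifferenceCLM k

lemma laplacianCLM_apply {N : ℕ} (g : (Fin N → ℤ) →ᵇ ℝ) :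
    ⇑(laplacianCLM N g) = discreteLaplacian g := by
  ext n
  have : laplacianCLM N g n =
      BoundedContinuousFunction.evalCLM ℝ n (∑ k, secondDifferenceCLM k g) := by
    simp [laplacianCLM]
  rw [this, map_sum]
  simp [discreteLaplacian, secondDifferenceCLM, sub_eq_add_neg]

lemma laplacianCLM_pow_apply {N : ℕ} (g : (Fin N → ℤ) →ᵇ ℝ) (j : ℕ) :
    ⇑((laplacianCLM N ^ j) g) = discreteLaplacian^[j] g := by
  induction j with
  | zero => simp
  | succ j ih =>
    rw [pow_succ', Function.iterate_succ_apply', ← ih, ← laplacianCLM_apply]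
    rfl

/-- The exponential of a bounded operator. -/
def operatorExp {E : Type*} [NormedAddCommGroup E] [NormedSpace ℝ E] (A : E →L[ℝ] E) :
    E →L[ℝ] E := NormedSpace.exp A

lemma hasSum_operatorExp_apply {E : Type*} [NormedAddCommGroup E] [NormedSpace ℝ E]
    [CompleteSpace E] (A : E →L[ℝ] E) (t : ℝ) (g : E) :
    HasSum (fun j : ℕ => (t ^ j / (j ! : ℝ)) • (A ^ j) g) (operatorExp (t • A) g) := by
  have h := NormedSpace.exp_series_hasSum_exp' (𝕂 := ℝ) (t • A)
  refine ((ContinuousLinearMap.apply ℝ E g).hasSum h).congr_fun fun j => ?_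
  simp [smul_pow, smul_smul, div_eq_inv_mul]

lemma operatorExp_add {E : Type*} [NormedAddCommGroup E] [NormedSpace ℝ E] [CompleteSpace E]
    {A B : E →L[ℝ] E} (h : Commute A B) :
    operatorExp (A + B) = operatorExp A * operatorExp B := by
  let : NormedAlgebra ℚ (E →L[ℝ] E) := NormedAlgebra.restrictScalars ℚ ℝ _
  exact NormedSpace.exp_add_of_commute h

lemma operatorExp_smul_one_apply {E : Type*} [NormedAddCommGroup E] [NormedSpace ℝ E]
    [CompleteSpace E] (c : ℝ) (g : E) :
    operatorExp (c • (1 : E →L[ℝ] E)) g = Real.exp c • g := by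
  have h := hasSum_operatorExp_apply (1 : E →L[ℝ] E) c g
  have he : HasSum (fun n : ℕ => c ^ n / (n ! : ℝ)) (Real.exp c) := by
    rw [Real.exp_eq_exp_ℝ]; exact NormedSpace.expSeries_div_hasSum_exp c
  refine h.unique ((he.smul_const g).congr_fun fun j => ?_)
  simp

lemma hasSum_operatorExp_apply_apply {N : ℕ}
    (A : ((Fin N → ℤ) →ᵇ ℝ) →L[ℝ] ((Fin N → ℤ) →ᵇ ℝ)) (t : ℝ)
    (g : (Fin N → ℤ) →ᵇ ℝ) (n : Fin N → ℤ) :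
    HasSum (fun j : ℕ => t ^ j / (j ! : ℝ) * (A ^ j) g n) (operatorExp (t • A) g n) :=
  (BoundedContinuousFunction.evalCLM ℝ n).hasSum (hasSum_operatorExp_apply A t g)

lemma hasSum_discreteHeatTerm {N : ℕ} (t : ℝ) (g : (Fin N → ℤ) →ᵇ ℝ) (n : Fin N → ℤ) :
    HasSum (discreteHeatTerm t g n) (operatorExp (t • laplacianCLM N) g n) := by
  have h := hasSum_operatorExp_apply_apply (laplacianCLM N) t g n
  simp_rw [laplacianCLM_pow_apply] at h
  exact h

lemma hasSum_operatorExp_translationCLM {N : ℕ} (t : ℝ) (v : Fin N → ℤ)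
    (g : (Fin N → ℤ) →ᵇ ℝ) (n : Fin N → ℤ) :
    HasSum (fun j : ℕ => t ^ j / (j ! : ℝ) * g (n + (j : ℤ) • v))
      (operatorExp (t • translationCLM v) g n) := by
  have h := hasSum_operatorExp_apply_apply (translationCLM v) t g n
  simp_rw [translationCLM_pow] at h
  exact h

/-- The one-dimensional heat flow is convolution with the Bessel kernel. -/
lemma hasSum_operatorExp_secondDifferenceCLM {N : ℕ} (t : ℝ) (k : Fin N)
    (g : (Fin N → ℤ) →ᵇ ℝ) (n : Fin N → ℤ) :
    HasSum (fun m : ℤ => besselKernel t m * g (n + m • Pi.single k 1))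
      (operatorExp (t • secondDifferenceCLM k) g n) := by
  set e : Fin N → ℤ := Pi.single k 1
  have hsplit : operatorExp (t • secondDifferenceCLM k) g n =
      Real.exp (-2 * t) *
        operatorExp (t • translationCLM e) (operatorExp (t • translationCLM (-e)) g) n := by
    have hone : Commute (1 : ((Fin N → ℤ) →ᵇ ℝ) →L[ℝ] ((Fin N → ℤ) →ᵇ ℝ))
        (t • translationCLM e + t • translationCLM (-e)) := Commute.one_left _
    have hone' := commute_smul_operators hone (-2 * t) 1
    rw [one_smul] at hone'
    rw [secondDifferenceCLM, smul_symmetric_difference, operatorExp_add hone',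
      operatorExp_add (commute_smul_operators (commute_translationCLM _ _) t t)]
    change operatorExp ((-2 * t) • (1 : ((Fin N → ℤ) →ᵇ ℝ) →L[ℝ] ((Fin N → ℤ) →ᵇ ℝ)))
      (operatorExp (t • translationCLM e) (operatorExp (t • translationCLM (-e)) g)) n = _
    rw [operatorExp_smul_one_apply]
    rfl
  have hb : ∀ m : ℤ, |g (n + m • e)| ≤ ‖g‖ := fun m => g.norm_coe_le_norm _
  -- One absolutely convergent double series is summed in two ways: along `i - j = m` it gives the
  -- Bessel series, and over `j` first it gives the composition of the two shift exponentials.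
  have hB := hasSum_modifiedBesselI_mul t (fun m => g (n + m • e)) ‖g‖ hb
  have hD := (summable_pow_div_factorial_mul t (fun m => g (n + m • e)) ‖g‖ hb).hasSum
  have hD2 := hD.prod_fiberwise
    (g := fun i => t ^ i / (i ! : ℝ) *
      operatorExp (t • translationCLM (-e)) g (n + (i : ℤ) • e)) fun i => by
    refine ((hasSum_operatorExp_translationCLM t (-e) g (n + (i : ℤ) • e)).mul_left
      (t ^ i / (i ! : ℝ))).congr_fun fun j => ?_
    rw [mul_assoc, sub_smul, smul_neg, ← sub_eq_add_neg, add_sub_assoc]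
  rw [hsplit, (hasSum_operatorExp_translationCLM t e _ n).unique hD2]
  refine (hB.mul_left (Real.exp (-2 * t))).congr_fun fun m => ?_
  rw [besselKernel, mul_assoc]

/-! ### The semigroup as convolution with the kernel -/

/-- A function with finite support as a bounded function. -/
def boundedOfFiniteSupport {N : ℕ} (f : (Fin N → ℤ) → ℝ) (hf : (Function.support f).Finite) :
    (Fin N → ℤ) →ᵇ ℝ :=
  BoundedContinuousFunction.ofNormedAddCommGroupDiscrete f (∑ m ∈ hf.toFinset, ‖f m‖) fun n => by
    by_cases hn : f n = 0
    · rw [hn, norm_zero]; positivity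
    · exact Finset.single_le_sum (f := fun m => ‖f m‖) (fun _ _ => norm_nonneg _)
        (by simpa using hn)

@[simp] lemma coe_boundedOfFiniteSupport {N : ℕ} (f : (Fin N → ℤ) → ℝ)
    (hf : (Function.support f).Finite) : ⇑(boundedOfFiniteSupport f hf) = f := rfl

/-- The unit mass at `a`. -/
def unitMass {N : ℕ} (a : Fin N → ℤ) : (Fin N → ℤ) →ᵇ ℝ :=
  boundedOfFiniteSupport (Pi.single a 1) ((Set.finite_singleton a).subset (by simp))

lemma unitMass_apply {N : ℕ} (a n : Fin N → ℤ) :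
    unitMass a n = ∏ l, if n l = a l then (1 : ℝ) else 0 := by
  rw [unitMass, coe_boundedOfFiniteSupport, Finset.prod_ite_zero, Pi.single_apply]
  simp [funext_iff]

/-- The directions commute, so they can be switched on one at a time; each application turns one
factor of the unit mass into a Bessel factor. -/
lemma operatorExp_sum_secondDifferenceCLM_unitMass {N : ℕ} (t : ℝ) (a : Fin N → ℤ)
    (s : Finset (Fin N)) (n : Fin N → ℤ) :
    operatorExp (t • ∑ k ∈ s, secondDifferenceCLM k) (unitMass a) n =
      ∏ l, if l ∈ s then besselKernel t (n l - a l) else if n l = a l then 1 else 0 := by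
  induction s using Finset.induction_on generalizing n with
  | empty =>
    have h := operatorExp_smul_one_apply 0 (unitMass a)
    rw [zero_smul, Real.exp_zero, one_smul] at h
    rw [Finset.sum_empty, smul_zero, h, unitMass_apply]
    simp
  | insert k s hk ih =>
    rw [Finset.sum_insert hk, smul_add, operatorExp_add]
    swap
    · exact commute_smul_operators (Commute.sum_right _ _ _ fun l _ =>
        commute_secondDifferenceCLM k l) t t
    have h := hasSum_operatorExp_secondDifferenceCLM t k
      (operatorExp (t • ∑ k ∈ s, secondDifferenceCLM k) (unitMass a)) n
    refine h.unique ?_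
    simp_rw [ih]
    -- In the direction `k` the function is still a point mass, so only the shift landing on `a k`
    -- contributes.
    have hz : ∀ m : ℤ, m ≠ a k - n k → besselKernel t m *
        (∏ l, if l ∈ s then besselKernel t ((n + m • Pi.single k 1 : Fin N → ℤ) l - a l)
          else if (n + m • Pi.single k 1 : Fin N → ℤ) l = a l then (1 : ℝ) else 0) = 0 := by
      intro m hm
      rw [Finset.prod_eq_zero (Finset.mem_univ k), mul_zero]
      rw [if_neg hk, if_neg]
      simp
      omega
    convert hasSum_single _ hz using 1
    rw [← Finset.mul_prod_erase _ _ (Finset.mem_univ k),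
      ← Finset.mul_prod_erase _ _ (Finset.mem_univ k)]
    rw [if_pos (Finset.mem_insert_self _ _), if_neg hk, if_pos (by simp), one_mul]
    congr 1
    -- The surviving shift is `a k - n k`; the kernel is even.
    · rw [besselKernel, besselKernel, ← modifiedBesselI_neg, neg_sub]
    · refine Finset.prod_congr rfl fun l hl => ?_
      have hl' : l ≠ k := Finset.ne_of_mem_erase hl
      simp [Finset.mem_insert, hl']

/-- The heat semigroup is convolution with the heat kernel. -/
lemma hasSum_discreteHeatTerm_kernel {N : ℕ} (t : ℝ) (f : (Fin N → ℤ) → ℝ)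
    (hf : (Function.support f).Finite) (n : Fin N → ℤ) :
    HasSum (discreteHeatTerm t f n) (∑ m ∈ hf.toFinset, discreteHeatKernel t (n - m) * f m) := by
  have h := hasSum_discreteHeatTerm t (boundedOfFiniteSupport f hf) n
  rw [coe_boundedOfFiniteSupport] at h
  convert h using 1
  have hdec : boundedOfFiniteSupport f hf = ∑ m ∈ hf.toFinset, f m • unitMass m := by
    ext x
    have h1 : (∑ m ∈ hf.toFinset, f m • unitMass m) x =
        BoundedContinuousFunction.evalCLM ℝ x (∑ m ∈ hf.toFinset, f m • unitMass m) := rfl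
    rw [h1, map_sum]
    simp only [BoundedContinuousFunction.evalCLM_apply, coe_boundedOfFiniteSupport]
    have h2 : ∀ m, (f m • unitMass m) x = if x = m then f m else 0 := by
      intro m
      simp [unitMass, Pi.single_apply]
    simp_rw [h2]
    simp +contextual
  rw [hdec, map_sum]
  have h1 : (∑ m ∈ hf.toFinset, operatorExp (t • laplacianCLM N) (f m • unitMass m)) n =
      BoundedContinuousFunction.evalCLM ℝ n
        (∑ m ∈ hf.toFinset, operatorExp (t • laplacianCLM N) (f m • unitMass m)) := rfl
  rw [h1, map_sum]
  refine Finset.sum_congr rfl fun m _ => ?_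
  rw [map_smul, map_smul, BoundedContinuousFunction.evalCLM_apply, laplacianCLM,
    operatorExp_sum_secondDifferenceCLM_unitMass]
  simp [discreteHeatKernel_eq, mul_comm]

/-! ### Mass and bounds of the `N`-dimensional kernel -/

lemma discreteHeatKernel_nonneg {N : ℕ} {t : ℝ} (ht : 0 ≤ t) (m : Fin N → ℤ) :
    0 ≤ discreteHeatKernel t m :=
  Finset.prod_nonneg fun k _ => besselKernel_nonneg ht (m k)

lemma measurable_discreteHeatKernel {N : ℕ} (m : Fin N → ℤ) :
    Measurable fun t => discreteHeatKernel t m :=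
  Finset.measurable_fun_prod _ fun k _ => measurable_besselKernel (m k)

/-- The heat kernel has total mass one. -/
lemma hasSum_discreteHeatKernel (N : ℕ) (t : ℝ) :
    HasSum (fun m : Fin N → ℤ => discreteHeatKernel t m) 1 := by
  induction N with
  | zero =>
    convert hasSum_unique (fun m : Fin 0 → ℤ => discreteHeatKernel t m) using 1
    simp [discreteHeatKernel]
  | succ n ih =>
    have h1 := (hasSum_besselKernel t).mul ih (summable_mul_of_summable_norm
      (hasSum_besselKernel t).summable.norm ih.summable.norm)
    rw [one_mul] at h1
    rw [← (Fin.consEquiv fun _ : Fin (n + 1) => ℤ).hasSum_iff]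
    refine h1.congr_fun fun p => ?_
    simp [discreteHeatKernel_eq, Fin.prod_univ_succ, Fin.consEquiv]

lemma hasSum_discreteHeatKernel_ne_zero (N : ℕ) (t : ℝ) :
    HasSum (fun m : {m : Fin N → ℤ // m ≠ 0} => discreteHeatKernel t m.1)
      (1 - discreteHeatKernel t (0 : Fin N → ℤ)) := by
  have h := (hasSum_discreteHeatKernel N t).update 0 0
  rw [zero_sub, neg_add_eq_sub] at h
  change HasSum ((fun m : Fin N → ℤ => discreteHeatKernel t m) ∘
    ((↑) : {m : Fin N → ℤ | m ≠ 0} → (Fin N → ℤ))) _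
  rw [hasSum_subtype_iff_indicator]
  refine h.congr_fun fun m => ?_
  by_cases hm : m = 0 <;> simp [hm]

/-- Keeping the zeroth Bessel term in each coordinate gives `G_t(0) ≥ e^{-2Nt} ≥ 1 - 2Nt`. -/
lemma one_sub_discreteHeatKernel_zero_le (N : ℕ) {t : ℝ} (ht : 0 ≤ t) :
    1 - discreteHeatKernel t (0 : Fin N → ℤ) ≤ 2 * N * t := by
  have h1 : Real.exp (-2 * t) ^ N ≤ discreteHeatKernel t (0 : Fin N → ℤ) := by
    rw [discreteHeatKernel_eq]
    simpa using pow_le_pow_left₀ (Real.exp_pos _).le (exp_le_besselKernel_zero ht) N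
  rw [← Real.exp_nat_mul] at h1
  have h2 := Real.add_one_le_exp (N * (-2 * t))
  linarith

lemma discreteHeatKernel_le_one {N : ℕ} {t : ℝ} (ht : 0 ≤ t) (m : Fin N → ℤ) :
    discreteHeatKernel t m ≤ 1 :=
  Finset.prod_le_one (fun k _ => besselKernel_nonneg ht (m k))
    fun k _ => besselKernel_le_one ht (m k)

lemma discreteHeatKernel_le_of_ne_zero {N : ℕ} {t : ℝ} (ht : 0 ≤ t) {m : Fin N → ℤ} (hm : m ≠ 0) :
    discreteHeatKernel t m ≤ 2 * N * t :=
  (le_hasSum (hasSum_discreteHeatKernel_ne_zero N t) ⟨m, hm⟩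
    fun k _ => discreteHeatKernel_nonneg ht k.1).trans (one_sub_discreteHeatKernel_zero_le N ht)

/-- One coordinate supplies the decay and the others are at most `1`. This is already integrable
against `dt/t` at infinity. -/
lemma discreteHeatKernel_le_rpow {N : ℕ} (hN : N ≠ 0) {t : ℝ} (ht : 1 ≤ t) (m : Fin N → ℤ) :
    discreteHeatKernel t m ≤ t ^ (-(1 / 2) : ℝ) := by
  have h0 : 0 ≤ t := by linarith
  let k : Fin N := ⟨0, Nat.pos_of_ne_zero hN⟩
  rw [discreteHeatKernel_eq, ← Finset.mul_prod_erase _ _ (Finset.mem_univ k)]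
  refine (mul_le_of_le_one_right (besselKernel_nonneg h0 _) ?_).trans (besselKernel_le_rpow ht _)
  exact Finset.prod_le_one (fun k _ => besselKernel_nonneg h0 (m k))
    fun k _ => besselKernel_le_one h0 (m k)

/-! ### Regularized kernel and its Mellin integrals -/

/-- The heat kernel with its initial value subtracted for `t ≤ 1`. -/
def regularizedKernel {N : ℕ} (t : ℝ) (a : Fin N → ℤ) : ℝ :=
  discreteHeatKernel t a - if a = 0 ∧ t ≤ 1 then 1 else 0

/-- A bound for `regularizedKernel` that does not depend on the lattice point. -/
def kernelBound (N : ℕ) (t : ℝ) : ℝ := if t ≤ 1 then 2 * N * t else t ^ (-(1 / 2) : ℝ)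

/-- An integrable bound for `kernelBound N t / t ^ (s + 1)`, `0 ≤ s ≤ r`. -/
def kernelDominant (N : ℕ) (r t : ℝ) : ℝ :=
  if t ≤ 1 then 2 * N * t ^ (-r) else t ^ (-(3 / 2) : ℝ)

lemma measurable_regularizedKernel {N : ℕ} (a : Fin N → ℤ) :
    Measurable fun t => regularizedKernel t a := by
  refine (measurable_discreteHeatKernel a).sub (Measurable.ite ?_ measurable_const measurable_const)
  exact (MeasurableSet.const _).inter measurableSet_Iic

lemma measurable_kernelBound (N : ℕ) : Measurable (kernelBound N) :=
  Measurable.ite measurableSet_Iic (by fun_prop) (by fun_prop)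

lemma abs_regularizedKernel_le {N : ℕ} (hN : N ≠ 0) {t : ℝ} (ht : 0 < t) (a : Fin N → ℤ) :
    |regularizedKernel t a| ≤ kernelBound N t := by
  have h0 := discreteHeatKernel_nonneg ht.le a
  rw [regularizedKernel, kernelBound]
  by_cases h1 : t ≤ 1
  · by_cases ha : a = 0
    · subst ha
      rw [if_pos ⟨rfl, h1⟩, if_pos h1, abs_sub_comm,
        abs_of_nonneg (by linarith [discreteHeatKernel_le_one ht.le (0 : Fin N → ℤ)])]
      exact one_sub_discreteHeatKernel_zero_le N ht.le
    · rw [if_neg (by simp [ha]), if_pos h1, sub_zero, abs_of_nonneg h0]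
      exact discreteHeatKernel_le_of_ne_zero ht.le ha
  · rw [if_neg (by simp [h1]), if_neg h1, sub_zero, abs_of_nonneg h0]
    exact discreteHeatKernel_le_rpow hN (by linarith) a

lemma kernelBound_nonneg (N : ℕ) {t : ℝ} (ht : 0 < t) : 0 ≤ kernelBound N t := by
  rw [kernelBound]; split_ifs <;> positivity

lemma kernelBound_div_le (N : ℕ) {t : ℝ} (ht : 0 < t) {s r : ℝ} (hs : 0 ≤ s) (hsr : s ≤ r) :
    kernelBound N t / t ^ (s + 1) ≤ kernelDominant N r t := by
  rw [kernelBound, kernelDominant, div_eq_mul_inv, ← Real.rpow_neg ht.le]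
  split_ifs with h1
  · have h2 : t * t ^ (-(s + 1)) = t ^ (-s) := by
      nth_rewrite 1 [← Real.rpow_one t]
      rw [← Real.rpow_add ht]
      congr 1; ring
    rw [mul_assoc, h2]
    gcongr 2 * (N : ℝ) * ?_
    exact Real.rpow_le_rpow_of_exponent_ge ht h1 (by linarith)
  -- The exponent `-1/2 - (s+1)` is at most `-3/2`, as `s ≥ 0`.
  · rw [← Real.rpow_add ht]
    exact Real.rpow_le_rpow_of_exponent_le (by linarith) (by linarith)

lemma integrableOn_kernelDominant (N : ℕ) {r : ℝ} (hr : r < 1) :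
    IntegrableOn (kernelDominant N r) (Ioi 0) := by
  rw [← Ioc_union_Ioi_eq_Ioi (zero_le_one (α := ℝ))]
  refine IntegrableOn.union ?_ ?_
  · have h1 : IntegrableOn (fun t : ℝ => 2 * N * t ^ (-r)) (Ioc 0 1) :=
      ((intervalIntegrable_iff_integrableOn_Ioc_of_le zero_le_one).mp
        (intervalIntegral.intervalIntegrable_rpow' (by linarith))).const_mul _
    exact h1.congr_fun (fun t ht => by simp [kernelDominant, ht.2]) measurableSet_Ioc
  · have h1 : IntegrableOn (fun t : ℝ => t ^ (-(3 / 2) : ℝ)) (Ioi 1) :=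
      integrableOn_Ioi_rpow_of_lt (by norm_num) one_pos
    refine h1.congr_fun (fun t ht => ?_) measurableSet_Ioi
    simp only [kernelDominant]
    rw [if_neg (not_le.mpr ht)]

lemma integrableOn_kernelBound_div (N : ℕ) {s : ℝ} (hs : 0 ≤ s) (hs1 : s < 1) :
    IntegrableOn (fun t => kernelBound N t / t ^ (s + 1)) (Ioi 0) := by
  refine (integrableOn_kernelDominant N hs1).mono' ?_ ?_
  · exact ((measurable_kernelBound N).div (by fun_prop)).aestronglyMeasurable
  · filter_upwards [ae_restrict_mem measurableSet_Ioi] with t ht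
    have ht' : 0 < t := ht
    rw [Real.norm_of_nonneg (div_nonneg (kernelBound_nonneg N ht') (by positivity))]
    exact kernelBound_div_le N ht' hs le_rfl

lemma integrableOn_regularizedKernel_div {N : ℕ} (hN : N ≠ 0) (a : Fin N → ℤ) {s : ℝ}
    (hs : 0 ≤ s) (hs1 : s < 1) :
    IntegrableOn (fun t => regularizedKernel t a / t ^ (s + 1)) (Ioi 0) := by
  refine (integrableOn_kernelBound_div N hs hs1).mono' ?_ ?_
  · exact ((measurable_regularizedKernel a).div (by fun_prop)).aestronglyMeasurable
  · filter_upwards [ae_restrict_mem measurableSet_Ioi] with t ht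
    have ht' : 0 < t := ht
    rw [norm_div, Real.norm_eq_abs, Real.norm_of_nonneg (by positivity : 0 ≤ t ^ (s + 1))]
    gcongr
    exact abs_regularizedKernel_le hN ht' a

/-- `∫_0^∞ regularizedKernel t a dt / t^{s+1}`. -/
def regularizedKernelMellin {N : ℕ} (s : ℝ) (a : Fin N → ℤ) : ℝ :=
  ∫ t in Ioi (0 : ℝ), regularizedKernel t a / t ^ (s + 1)

lemma regularizedKernel_of_ne_zero {N : ℕ} {a : Fin N → ℤ} (ha : a ≠ 0) (t : ℝ) :
    regularizedKernel t a = discreteHeatKernel t a := by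
  simp [regularizedKernel, ha]

lemma regularizedKernel_of_one_lt {N : ℕ} (a : Fin N → ℤ) {t : ℝ} (ht : 1 < t) :
    regularizedKernel t a = discreteHeatKernel t a := by
  simp [regularizedKernel, not_le.mpr ht]

lemma integrableOn_regularizedKernel_div_self {N : ℕ} (hN : N ≠ 0) (a : Fin N → ℤ) :
    IntegrableOn (fun t => regularizedKernel t a / t) (Ioi 0) := by
  simpa using integrableOn_regularizedKernel_div hN a le_rfl zero_lt_one

lemma integrableOn_discreteHeatKernel_div {N : ℕ} (hN : N ≠ 0) {a : Fin N → ℤ} (ha : a ≠ 0) :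
    IntegrableOn (fun t => discreteHeatKernel t a / t) (Ioi 0) := by
  simpa [regularizedKernel_of_ne_zero ha] using integrableOn_regularizedKernel_div_self hN a

lemma integrableOn_discreteHeatKernel_div_Ioi_one {N : ℕ} (hN : N ≠ 0) (a : Fin N → ℤ) :
    IntegrableOn (fun t => discreteHeatKernel t a / t) (Ioi 1) :=
  ((integrableOn_regularizedKernel_div_self hN a).mono_set
    (Ioi_subset_Ioi zero_le_one)).congr_fun
    (fun t ht => by simp only [regularizedKernel_of_one_lt a ht]) measurableSet_Ioi

/-- For `t ≤ 1` the mass off the origin is `1 - G_t(0) = -ψ_t(0)`. Nonnegativity bounds the partial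
sums by its integral, which justifies exchanging sum and integral. -/
lemma hasSum_integral_discreteHeatKernel_div {N : ℕ} (hN : N ≠ 0) :
    HasSum (fun m : {m : Fin N → ℤ // m ≠ 0} =>
      ∫ t in Ioc (0 : ℝ) 1, discreteHeatKernel t m.1 / t)
      (-∫ t in Ioc (0 : ℝ) 1, regularizedKernel t (0 : Fin N → ℤ) / t) := by
  have hint : ∀ m : {m : Fin N → ℤ // m ≠ 0},
      IntegrableOn (fun t => discreteHeatKernel t m.1 / t) (Ioc 0 1) := fun m =>
    (integrableOn_discreteHeatKernel_div hN m.2).mono_set Ioc_subset_Ioi_self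
  have hreg : IntegrableOn (fun t => regularizedKernel t (0 : Fin N → ℤ) / t) (Ioc 0 1) :=
    (integrableOn_regularizedKernel_div_self hN 0).mono_set Ioc_subset_Ioi_self
  have hval : ∀ t ∈ Ioc (0 : ℝ) 1, HasSum (fun m : {m : Fin N → ℤ // m ≠ 0} =>
      discreteHeatKernel t m.1 / t) (-(regularizedKernel t (0 : Fin N → ℤ) / t)) := by
    intro t ht
    have hv : -(regularizedKernel t (0 : Fin N → ℤ) / t) =
        (1 - discreteHeatKernel t (0 : Fin N → ℤ)) / t := by
      rw [regularizedKernel, if_pos ⟨rfl, ht.2⟩]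
      ring
    rw [hv]
    exact (hasSum_discreteHeatKernel_ne_zero N t).div_const t
  have hnn : ∀ m : {m : Fin N → ℤ // m ≠ 0}, ∀ t ∈ Ioc (0 : ℝ) 1,
      0 ≤ discreteHeatKernel t m.1 / t := fun m t ht =>
    div_nonneg (discreteHeatKernel_nonneg ht.1.le _) ht.1.le
  have hsum : Summable fun m : {m : Fin N → ℤ // m ≠ 0} =>
      ∫ t in Ioc (0 : ℝ) 1, discreteHeatKernel t m.1 / t := by
    refine summable_of_sum_le (c := ∫ t in Ioc (0 : ℝ) 1,
      -(regularizedKernel t (0 : Fin N → ℤ) / t))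
      (fun m => setIntegral_nonneg measurableSet_Ioc (hnn m)) fun u => ?_
    rw [← integral_finsetSum _ fun m _ => hint m]
    refine setIntegral_mono_on (integrable_finsetSum _ fun m _ => hint m) hreg.neg
      measurableSet_Ioc fun t ht => ?_
    exact sum_le_hasSum u (fun m _ => hnn m t ht) (hval t ht)
  have hsum' : Summable fun m : {m : Fin N → ℤ // m ≠ 0} =>
      ∫ t in Ioc (0 : ℝ) 1, ‖discreteHeatKernel t m.1 / t‖ := by
    refine hsum.congr fun m => setIntegral_congr_fun measurableSet_Ioc fun t ht => ?_
    exact (Real.norm_of_nonneg (hnn m t ht)).symm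
  have h := hasSum_integral_of_summable_integral_norm hint hsum'
  rw [setIntegral_congr_fun measurableSet_Ioc fun t ht => (hval t ht).tsum_eq, integral_neg] at h
  exact h

lemma logKernel_of_ne_zero {N : ℕ} {a : Fin N → ℤ} (ha : a ≠ 0) :
    logKernel a = regularizedKernelMellin 0 a := by
  rw [logKernel, if_neg ha, regularizedKernelMellin]
  simp [regularizedKernel_of_ne_zero ha]

/-- Splitting `M_0(0)` at `t = 1` yields minus the off-origin series on `(0, 1]` plus the tail
integral of `G_t(0)`. -/
lemma logCorrector_eq {N : ℕ} (hN : N ≠ 0) :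
    logCorrector N =
      -regularizedKernelMellin 0 (0 : Fin N → ℤ) - Real.eulerMascheroniConstant := by
  have h0 := integrableOn_regularizedKernel_div_self hN (0 : Fin N → ℤ)
  have h1 : regularizedKernelMellin 0 (0 : Fin N → ℤ) =
      (∫ t in Ioc (0 : ℝ) 1, regularizedKernel t (0 : Fin N → ℤ) / t) +
        ∫ t in Ioi (1 : ℝ), discreteHeatKernel t (0 : Fin N → ℤ) / t := by
    have h2 : (∫ t in Ioi (1 : ℝ), discreteHeatKernel t (0 : Fin N → ℤ) / t) =
        ∫ t in Ioi (1 : ℝ), regularizedKernel t (0 : Fin N → ℤ) / t :=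
      setIntegral_congr_fun measurableSet_Ioi fun t ht => by
        simp only [regularizedKernel_of_one_lt _ ht]
    rw [h2, ← setIntegral_union (Ioc_disjoint_Ioi le_rfl) measurableSet_Ioi
      (h0.mono_set Ioc_subset_Ioi_self) (h0.mono_set (Ioi_subset_Ioi zero_le_one)),
      Ioc_union_Ioi_eq_Ioi zero_le_one, regularizedKernelMellin]
    simp
  rw [logCorrector, (hasSum_integral_discreteHeatKernel_div hN).tsum_eq, h1]
  ring

lemma regularizedKernelMellin_zero {N : ℕ} (a : Fin N → ℤ) :
    regularizedKernelMellin 0 a = ∫ t in Ioi (0 : ℝ), regularizedKernel t a / t := by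
  simp [regularizedKernelMellin]

lemma abs_regularizedKernelMellin_zero_le {N : ℕ} (hN : N ≠ 0) (a : Fin N → ℤ) :
    |regularizedKernelMellin 0 a| ≤ ∫ t in Ioi (0 : ℝ), kernelBound N t / t := by
  rw [regularizedKernelMellin_zero, ← Real.norm_eq_abs]
  refine norm_integral_le_of_norm_le (by
    simpa [IntegrableOn] using integrableOn_kernelBound_div N le_rfl zero_lt_one) ?_
  filter_upwards [ae_restrict_mem measurableSet_Ioi] with t ht
  have ht' : 0 < t := ht
  rw [norm_div, Real.norm_eq_abs, Real.norm_of_nonneg ht'.le]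
  gcongr
  exact abs_regularizedKernel_le hN ht' a

/-- The error in replacing `c ∫ ψ dt / t^{s+1}` by `∫ ψ dt / t`. -/
def mellinError (N : ℕ) (s c : ℝ) : ℝ :=
  ∫ t in Ioi (0 : ℝ), kernelBound N t * |1 / t - c / t ^ (s + 1)|

lemma abs_kernelBound_mul_le (N : ℕ) {t : ℝ} (ht : 0 < t) {s r : ℝ} (hs : 0 ≤ s) (hsr : s ≤ r)
    (c : ℝ) :
    ‖kernelBound N t * |1 / t - c / t ^ (s + 1)|‖ ≤ (1 + |c|) * kernelDominant N r t := by
  have hb := kernelBound_nonneg N ht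
  have h1 := kernelBound_div_le N ht le_rfl (hs.trans hsr)
  have h2 := kernelBound_div_le N ht hs hsr
  rw [zero_add, Real.rpow_one] at h1
  rw [norm_mul, Real.norm_of_nonneg hb, Real.norm_eq_abs, abs_abs]
  have h3 : |1 / t - c / t ^ (s + 1)| ≤ 1 / t + |c| / t ^ (s + 1) := by
    refine (abs_sub _ _).trans (le_of_eq ?_)
    rw [abs_div, abs_div, abs_one, abs_of_pos ht, abs_of_pos (Real.rpow_pos_of_pos ht _)]
  calc kernelBound N t * |1 / t - c / t ^ (s + 1)|
      ≤ kernelBound N t * (1 / t + |c| / t ^ (s + 1)) := by gcongr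
    _ = kernelBound N t / t + |c| * (kernelBound N t / t ^ (s + 1)) := by ring
    _ ≤ kernelDominant N r t + |c| * kernelDominant N r t := by gcongr
    _ = _ := by ring

lemma measurable_kernelBound_mul (N : ℕ) (s c : ℝ) :
    Measurable fun t => kernelBound N t * |1 / t - c / t ^ (s + 1)| := by
  have h : Measurable fun t : ℝ => |1 / t - c / t ^ (s + 1)| := by fun_prop
  exact (measurable_kernelBound N).mul h

/-- Replacing `ψ_t(a)` by its bound removes `a`; this is the source of uniformity in the lattice
point. -/
lemma abs_regularizedKernelMellin_sub_le {N : ℕ} (hN : N ≠ 0) (a : Fin N → ℤ) {s : ℝ}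
    (hs : 0 ≤ s) (hs1 : s < 1) (c : ℝ) :
    |regularizedKernelMellin 0 a - c * regularizedKernelMellin s a| ≤ mellinError N s c := by
  rw [regularizedKernelMellin_zero, regularizedKernelMellin, ← integral_const_mul,
    ← integral_sub (integrableOn_regularizedKernel_div_self hN a)
      ((integrableOn_regularizedKernel_div hN a hs hs1).const_mul c), ← Real.norm_eq_abs]
  refine norm_integral_le_of_norm_le ?_ ?_
  · refine ((integrableOn_kernelDominant N hs1).const_mul (1 + |c|)).mono'
      (measurable_kernelBound_mul N s c).aestronglyMeasurable ?_
    filter_upwards [ae_restrict_mem measurableSet_Ioi] with t ht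
    exact abs_kernelBound_mul_le N ht hs le_rfl c
  · filter_upwards [ae_restrict_mem measurableSet_Ioi] with t ht
    have ht' : 0 < t := ht
    rw [show regularizedKernel t a / t - c * (regularizedKernel t a / t ^ (s + 1)) =
      regularizedKernel t a * (1 / t - c / t ^ (s + 1)) by ring, norm_mul, Real.norm_eq_abs,
      Real.norm_eq_abs]
    gcongr
    exact abs_regularizedKernel_le hN ht' a

lemma tendsto_mellinError (N : ℕ) {c : ℝ → ℝ} (hc : Tendsto c (𝓝[>] 0) (𝓝 1)) :
    Tendsto (fun s => mellinError N s (c s)) (𝓝[>] 0) (𝓝 0) := by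
  have h := tendsto_integral_filter_of_dominated_convergence (l := 𝓝[>] (0 : ℝ))
    (μ := volume.restrict (Ioi (0 : ℝ)))
    (F := fun s t => kernelBound N t * |1 / t - c s / t ^ (s + 1)|) (f := fun _ => 0)
    -- The `2` bounds `|c s|` for small `s`, as `c → 1`; the `1/2` is an exponent below `1` that
    -- eventually exceeds `s`.
    (fun t => (1 + 2) * kernelDominant N (1 / 2) t) ?_ ?_ ?_ ?_
  · simpa [mellinError] using h
  · exact Eventually.of_forall fun s => (measurable_kernelBound_mul N s _).aestronglyMeasurable
  · have hc2 : ∀ᶠ s in 𝓝[>] (0 : ℝ), |c s| < 2 := by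
      refine hc.abs.eventually_lt_const ?_
      norm_num
    filter_upwards [hc2, Ioo_mem_nhdsGT (by norm_num : (0 : ℝ) < 1 / 2)] with s hcs hs
    filter_upwards [ae_restrict_mem measurableSet_Ioi] with t ht
    have ht' : 0 < t := ht
    refine (abs_kernelBound_mul_le N ht' hs.1.le hs.2.le (c s)).trans ?_
    have : 0 ≤ kernelDominant N (1 / 2) t := by
      rw [kernelDominant]; split_ifs <;> positivity
    gcongr
  · exact (integrableOn_kernelDominant N (by norm_num)).const_mul _
  · filter_upwards [ae_restrict_mem measurableSet_Ioi] with t ht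
    have ht' : 0 < t := ht
    have h1 : Tendsto (fun s : ℝ => t ^ (s + 1)) (𝓝[>] 0) (𝓝 (t ^ ((0 : ℝ) + 1))) := by
      refine Tendsto.mono_left ?_ nhdsWithin_le_nhds
      have : Continuous fun s : ℝ => t ^ (s + 1) :=
        Continuous.rpow continuous_const (by fun_prop) fun _ => Or.inl ht'.ne'
      exact this.tendsto 0
    rw [zero_add, Real.rpow_one] at h1
    have h2 := ((tendsto_const_nhds (x := 1 / t)).sub (hc.div h1 ht'.ne')).abs.const_mul
      (kernelBound N t)
    simpa using h2

/-! ### The Gamma factor near zero -/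

/-- `1 / Γ(1 - s)`. -/
def gammaFactor (s : ℝ) : ℝ := 1 / Real.Gamma (1 - s)

lemma hasDerivAt_gammaFactor : HasDerivAt gammaFactor (-Real.eulerMascheroniConstant) 0 := by
  have h1 : HasDerivAt (fun s : ℝ => 1 - s) (-1) 0 := by
    simpa using (hasDerivAt_id (0 : ℝ)).const_sub 1
  have h2 : HasDerivAt Real.Gamma (-Real.eulerMascheroniConstant) (1 - (0 : ℝ)) := by
    simpa using Real.hasDerivAt_Gamma_one
  have h3 := (h2.comp (0 : ℝ) h1).inv (by simp)
  have h4 : gammaFactor = fun s => (Real.Gamma (1 - s))⁻¹ := by ext s; simp [gammaFactor]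
  rw [h4]
  simpa [Function.comp_def, Pi.inv_def] using h3

lemma gammaFactor_zero : gammaFactor 0 = 1 := by simp [gammaFactor]

lemma tendsto_gammaFactor : Tendsto gammaFactor (𝓝[>] 0) (𝓝 1) := by
  have := hasDerivAt_gammaFactor.continuousAt.tendsto
  rw [gammaFactor_zero] at this
  exact this.mono_left nhdsWithin_le_nhds

lemma tendsto_gammaFactor_slope :
    Tendsto (fun s => (gammaFactor s - 1) / s) (𝓝[>] 0) (𝓝 (-Real.eulerMascheroniConstant)) := by
  have h := (hasDerivWithinAt_iff_tendsto_slope' self_notMem_Ioi).mp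
    (hasDerivAt_gammaFactor.hasDerivWithinAt (s := Ioi 0))
  refine h.congr fun s => ?_
  rw [slope_def_field, gammaFactor_zero, sub_zero]

lemma one_div_Gamma_neg {s : ℝ} (hs : s ≠ 0) :
    1 / Real.Gamma (-s) = -s * gammaFactor s := by
  rw [gammaFactor, sub_eq_neg_add, Real.Gamma_add_one (neg_ne_zero.mpr hs)]
  rw [one_div, one_div, mul_inv, mul_inv_cancel_left₀ (neg_ne_zero.mpr hs)]

/-! ### Kernel formulas for the fractional and logarithmic Laplacians -/

lemma sum_mul_ite_sub_eq_zero {N : ℕ} {f : (Fin N → ℤ) → ℝ} (hf : (Function.support f).Finite)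
    (n : Fin N → ℤ) (x : ℝ) :
    ∑ m ∈ hf.toFinset, f m * (if n - m = 0 then x else 0) = f n * x := by
  simp_rw [sub_eq_zero, mul_ite, mul_zero, Finset.sum_ite_eq]
  by_cases hn : f n = 0 <;> simp [hn]

/-- For `t ≤ 1` the subtracted `f n` is absorbed into the regularized kernel; for `t > 1` it remains
as an explicit power tail. -/
lemma fracLaplacianIntegrand_eq {N : ℕ} {f : (Fin N → ℤ) → ℝ} (hf : (Function.support f).Finite)
    (n : Fin N → ℤ) (s : ℝ) {t : ℝ} (ht : 0 < t) :
    fracLaplacianIntegrand s f n t =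
      (∑ m ∈ hf.toFinset, f m * (regularizedKernel t (n - m) / t ^ (s + 1))) -
        f n * (Ioi (1 : ℝ)).indicator (fun t => t ^ (-(s + 1))) t := by
  have h1 : ∀ m, discreteHeatKernel t (n - m) * f m = f m * regularizedKernel t (n - m) +
      f m * (if n - m = 0 then (if t ≤ 1 then 1 else 0) else 0) := by
    intro m
    rw [regularizedKernel, ite_and]
    ring
  rw [fracLaplacianIntegrand, discreteHeatSemigroup,
    (hasSum_discreteHeatTerm_kernel t f hf n).tsum_eq]
  simp_rw [h1]
  rw [Finset.sum_add_distrib, sum_mul_ite_sub_eq_zero]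
  simp_rw [mul_div_assoc']
  rw [← Finset.sum_div, indicator_apply, Real.rpow_neg ht.le]
  by_cases h : t ≤ 1
  · rw [if_pos h, if_neg (by simpa using h)]; ring
  · rw [if_neg h, if_pos (by simpa using h)]; ring

lemma integrableOn_indicator_rpow {s : ℝ} (hs : 0 < s) :
    IntegrableOn ((Ioi (1 : ℝ)).indicator fun t => t ^ (-(s + 1))) (Ioi 0) := by
  have h : IntegrableOn (fun t : ℝ => t ^ (-(s + 1))) (Ioi 1) :=
    integrableOn_Ioi_rpow_of_lt (by linarith) one_pos
  exact ((integrable_indicator_iff measurableSet_Ioi).mpr h).integrableOn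

lemma integral_indicator_rpow {s : ℝ} (hs : 0 < s) :
    ∫ t in Ioi (0 : ℝ), (Ioi (1 : ℝ)).indicator (fun t => t ^ (-(s + 1))) t = 1 / s := by
  rw [setIntegral_indicator measurableSet_Ioi, Ioi_inter_Ioi, max_eq_right zero_le_one,
    integral_Ioi_rpow_of_lt (by linarith) one_pos, Real.one_rpow]
  rw [show -(s + 1) + 1 = -s by ring, neg_div_neg_eq]

lemma integrableOn_fracLaplacianIntegrand {N : ℕ} (hN : N ≠ 0) {f : (Fin N → ℤ) → ℝ}
    (hf : (Function.support f).Finite) (n : Fin N → ℤ) {s : ℝ} (hs : s ∈ Ioo (0 : ℝ) 1) :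
    IntegrableOn (fracLaplacianIntegrand s f n) (Ioi 0) := by
  refine IntegrableOn.congr_fun (f := fun t =>
    (∑ m ∈ hf.toFinset, f m * (regularizedKernel t (n - m) / t ^ (s + 1))) -
        f n * (Ioi (1 : ℝ)).indicator (fun t => t ^ (-(s + 1))) t) ?_
    (fun t ht => (fracLaplacianIntegrand_eq hf n s ht).symm) measurableSet_Ioi
  exact (integrable_finsetSum _ fun m _ =>
    (integrableOn_regularizedKernel_div hN (n - m) hs.1.le hs.2).const_mul _).sub
    ((integrableOn_indicator_rpow hs.1).const_mul _)

lemma integral_fracLaplacianIntegrand {N : ℕ} (hN : N ≠ 0) {f : (Fin N → ℤ) → ℝ}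
    (hf : (Function.support f).Finite) (n : Fin N → ℤ) {s : ℝ} (hs : s ∈ Ioo (0 : ℝ) 1) :
    ∫ t in Ioi (0 : ℝ), fracLaplacianIntegrand s f n t =
      (∑ m ∈ hf.toFinset, f m * regularizedKernelMellin s (n - m)) - f n / s := by
  have hint := fun m => (integrableOn_regularizedKernel_div hN (n - m) hs.1.le hs.2).const_mul (f m)
  rw [setIntegral_congr_fun measurableSet_Ioi fun t ht => fracLaplacianIntegrand_eq hf n s ht,
    integral_sub (integrable_finsetSum _ fun m _ => hint m)
      ((integrableOn_indicator_rpow hs.1).const_mul _),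
    integral_finsetSum _ fun m _ => hint m, integral_const_mul, integral_indicator_rpow hs.1,
    mul_one_div]
  congr 1
  exact Finset.sum_congr rfl fun m _ => integral_const_mul _ _

/-- The prefactor `-s * gammaFactor s` turns the pole `-f n / s` into `gammaFactor s * f n`, leaving
the difference quotient of `gammaFactor` at `0`. -/
lemma fracDiscreteLaplacian_sub_div {N : ℕ} (hN : N ≠ 0) {f : (Fin N → ℤ) → ℝ}
    (hf : (Function.support f).Finite) (n : Fin N → ℤ) {s : ℝ} (hs : s ∈ Ioo (0 : ℝ) 1) :
    (fracDiscreteLaplacian s f n - f n) / s =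
      -(gammaFactor s * ∑ m ∈ hf.toFinset, f m * regularizedKernelMellin s (n - m)) +
        (gammaFactor s - 1) / s * f n := by
  have hs0 := hs.1.ne'
  rw [fracDiscreteLaplacian, if_neg hs0, one_div_Gamma_neg hs0,
    integral_fracLaplacianIntegrand hN hf n hs]
  field_simp
  ring

/-- The kernel formula for the logarithmic Laplacian, as a finite sum. -/
def logLaplacianSum {N : ℕ} {f : (Fin N → ℤ) → ℝ} (hf : (Function.support f).Finite)
    (n : Fin N → ℤ) : ℝ :=
  -(∑ m ∈ hf.toFinset, f m * regularizedKernelMellin 0 (n - m)) -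
    Real.eulerMascheroniConstant * f n

lemma logLaplacianSum_eq {N : ℕ} (hN : N ≠ 0) {f : (Fin N → ℤ) → ℝ}
    (hf : (Function.support f).Finite) (n : Fin N → ℤ) :
    logLaplacianSum hf n =
      -(∑' m : {m : Fin N → ℤ // m ≠ n}, logKernel (n - m.1) * f m.1) + logCorrector N * f n := by
  have h1 : (∑' m : {m : Fin N → ℤ // m ≠ n}, logKernel (n - m.1) * f m.1) =
      ∑ m ∈ hf.toFinset, logKernel (n - m) * f m := by
    change (∑' m : {m : Fin N → ℤ | m ≠ n}, logKernel (n - m.1) * f m.1) = _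
    rw [tsum_subtype {m : Fin N → ℤ | m ≠ n} fun m => logKernel (n - m) * f m]
    rw [tsum_eq_sum (s := hf.toFinset)]
    · refine Finset.sum_congr rfl fun m _ => ?_
      rw [indicator_apply_eq_self]
      intro hm
      replace hm : m = n := not_not.mp hm
      simp [hm, logKernel]
    · intro m hm
      have : f m = 0 := by simpa using hm
      simp [this]
  -- `logKernel 0 = 0`, so the diagonal value of the Mellin integral is carried separately and
  -- enters the corrector.
  have h2 : ∀ m, f m * regularizedKernelMellin 0 (n - m) = logKernel (n - m) * f m +
      f m * (if n - m = 0 then regularizedKernelMellin 0 (0 : Fin N → ℤ) else 0) := by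
    intro m
    by_cases h : n - m = 0
    · rw [if_pos h, h, logKernel, if_pos rfl]; ring
    · rw [if_neg h, logKernel_of_ne_zero h]; ring
  rw [logLaplacianSum, h1, logCorrector_eq hN]
  simp_rw [h2]
  rw [Finset.sum_add_distrib, sum_mul_ite_sub_eq_zero]
  ring

lemma abs_apply_le_sum_support {N : ℕ} {f : (Fin N → ℤ) → ℝ} (hf : (Function.support f).Finite)
    (n : Fin N → ℤ) : |f n| ≤ ∑ m ∈ hf.toFinset, |f m| := by
  by_cases hn : f n = 0
  · rw [hn, abs_zero]; positivity
  · exact Finset.single_le_sum (f := fun m => |f m|) (fun _ _ => abs_nonneg _) (by simpa using hn)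

lemma abs_logLaplacianSum_le {N : ℕ} (hN : N ≠ 0) {f : (Fin N → ℤ) → ℝ}
    (hf : (Function.support f).Finite) (n : Fin N → ℤ) :
    |logLaplacianSum hf n| ≤ (∑ m ∈ hf.toFinset, |f m|) *
      ((∫ t in Ioi (0 : ℝ), kernelBound N t / t) + |Real.eulerMascheroniConstant|) := by
  rw [logLaplacianSum, mul_add, Finset.sum_mul]
  refine (abs_sub _ _).trans (add_le_add ?_ ?_)
  · rw [abs_neg]
    refine (Finset.abs_sum_le_sum_abs _ _).trans (Finset.sum_le_sum fun m _ => ?_)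
    rw [abs_mul]
    gcongr
    exact abs_regularizedKernelMellin_zero_le hN _
  · rw [abs_mul, mul_comm]
    gcongr
    exact abs_apply_le_sum_support hf n

/-! ### Uniform convergence of the difference quotients -/

/-- The uniform error of the difference quotient, per unit of `ℓ¹` norm. -/
def quotientError (N : ℕ) (s : ℝ) : ℝ :=
  mellinError N s (gammaFactor s) + |(gammaFactor s - 1) / s + Real.eulerMascheroniConstant|

lemma tendsto_quotientError (N : ℕ) : Tendsto (quotientError N) (𝓝[>] 0) (𝓝 0) := by
  have h := (tendsto_mellinError N tendsto_gammaFactor).add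
    (tendsto_gammaFactor_slope.add_const Real.eulerMascheroniConstant).abs
  rw [neg_add_cancel, abs_zero, add_zero] at h
  exact h

lemma abs_quotient_sub_logLaplacianSum_le {N : ℕ} (hN : N ≠ 0) {f : (Fin N → ℤ) → ℝ}
    (hf : (Function.support f).Finite) (n : Fin N → ℤ) {s : ℝ} (hs : s ∈ Ioo (0 : ℝ) 1) :
    |(fracDiscreteLaplacian s f n - f n) / s - logLaplacianSum hf n| ≤
      (∑ m ∈ hf.toFinset, |f m|) * quotientError N s := by
  have h1 : (fracDiscreteLaplacian s f n - f n) / s - logLaplacianSum hf n =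
      (∑ m ∈ hf.toFinset, f m * (regularizedKernelMellin 0 (n - m) -
        gammaFactor s * regularizedKernelMellin s (n - m))) +
      f n * ((gammaFactor s - 1) / s + Real.eulerMascheroniConstant) := by
    rw [fracDiscreteLaplacian_sub_div hN hf n hs, logLaplacianSum]
    simp_rw [mul_sub, mul_left_comm (f _) (gammaFactor s)]
    rw [Finset.sum_sub_distrib, ← Finset.mul_sum]
    ring
  rw [h1, quotientError, mul_add (∑ m ∈ hf.toFinset, |f m|), Finset.sum_mul]
  refine (abs_add_le _ _).trans (add_le_add ?_ ?_)
  · refine (Finset.abs_sum_le_sum_abs _ _).trans (Finset.sum_le_sum fun m _ => ?_)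
    rw [abs_mul]
    gcongr
    exact abs_regularizedKernelMellin_sub_le hN _ hs.1.le hs.2 _
  · rw [abs_mul]
    gcongr
    exact abs_apply_le_sum_support hf n

lemma hasDerivWithinAt_fracDiscreteLaplacian {N : ℕ} (hN : N ≠ 0) {f : (Fin N → ℤ) → ℝ}
    (hf : (Function.support f).Finite) (n : Fin N → ℤ) :
    HasDerivWithinAt (fun s : ℝ => fracDiscreteLaplacian s f n) (logLaplacianSum hf n)
      (Ioi 0) 0 := by
  rw [hasDerivWithinAt_iff_tendsto_slope' self_notMem_Ioi, tendsto_iff_norm_sub_tendsto_zero]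
  have hlim := (tendsto_quotientError N).const_mul (∑ m ∈ hf.toFinset, |f m|)
  rw [mul_zero] at hlim
  refine tendsto_of_tendsto_of_tendsto_of_le_of_le' tendsto_const_nhds hlim
    (Eventually.of_forall fun s => norm_nonneg _) ?_
  filter_upwards [Ioo_mem_nhdsGT (zero_lt_one (α := ℝ))] with s hs
  -- The slope at `0` is the difference quotient because the power `s = 0` is the identity by
  -- definition.
  rw [slope_def_field, sub_zero, show fracDiscreteLaplacian 0 f n = f n from if_pos rfl]
  exact abs_quotient_sub_logLaplacianSum_le hN hf n hs

lemma logDiscreteLaplacian_eq {N : ℕ} (hN : N ≠ 0) {f : (Fin N → ℤ) → ℝ}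
    (hf : (Function.support f).Finite) (n : Fin N → ℤ) :
    logDiscreteLaplacian f n = logLaplacianSum hf n :=
  (hasDerivWithinAt_fracDiscreteLaplacian hN hf n).derivWithin (uniqueDiffWithinAt_Ioi 0)

end

theorem theorem3p2 (N : ℕ) (hN : 2 ≤ N) (f : (Fin N → ℤ) → ℝ)
    (hf : (Function.support f).Finite) :
    -- the series and integrals defining `K`, `ρ_N`, `e^{tΔ_N} f` and `(-Δ_N)^s f` converge
    (∀ m : Fin N → ℤ, m ≠ 0 →
      IntegrableOn (fun t : ℝ => discreteHeatKernel t m / t) (Ioi 0)) ∧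
    (Summable fun m : {m : Fin N → ℤ // m ≠ 0} =>
      ∫ t in Ioc (0 : ℝ) 1, discreteHeatKernel t m.1 / t) ∧
    IntegrableOn (fun t : ℝ => discreteHeatKernel t (0 : Fin N → ℤ) / t) (Ioi 1) ∧
    (∀ (t : ℝ) (n : Fin N → ℤ), Summable (discreteHeatTerm t f n)) ∧
    (∀ s ∈ Ioo (0 : ℝ) 1, ∀ n : Fin N → ℤ,
      IntegrableOn (fracLaplacianIntegrand s f n) (Ioi 0)) ∧
    -- the right derivative at `0` exists and is given by the kernel formula
    (∀ n : Fin N → ℤ,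
      HasDerivWithinAt (fun s : ℝ => fracDiscreteLaplacian s f n)
        (logDiscreteLaplacian f n) (Ioi 0) 0 ∧
      logDiscreteLaplacian f n =
        -(∑' m : {m : Fin N → ℤ // m ≠ n}, logKernel (n - m.1) * f m.1)
          + logCorrector N * f n) ∧
    -- `log(-Δ_N) f` is bounded
    Memℓp (fun n : Fin N → ℤ => logDiscreteLaplacian f n) ∞ ∧
    -- the difference quotients converge in the supremum norm
    Tendsto
      (fun s : ℝ => ⨆ n : Fin N → ℤ,
        ‖(fracDiscreteLaplacian s f n - f n) / s - logDiscreteLaplacian f n‖ₑ)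
      (𝓝[>] 0) (𝓝 0) := by
  have hN0 : N ≠ 0 := by omega
  refine ⟨fun m hm => integrableOn_discreteHeatKernel_div hN0 hm,
    (hasSum_integral_discreteHeatKernel_div hN0).summable,
    integrableOn_discreteHeatKernel_div_Ioi_one hN0 0,
    fun t n => (hasSum_discreteHeatTerm_kernel t f hf n).summable,
    fun s hs n => integrableOn_fracLaplacianIntegrand hN0 hf n hs,
    fun n => ⟨?_, ?_⟩, ?_, ?_⟩
  · rw [logDiscreteLaplacian_eq hN0 hf]
    exact hasDerivWithinAt_fracDiscreteLaplacian hN0 hf n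
  · rw [logDiscreteLaplacian_eq hN0 hf, logLaplacianSum_eq hN0 hf]
  · refine memℓp_infty ⟨(∑ m ∈ hf.toFinset, |f m|) *
        ((∫ t in Ioi (0 : ℝ), kernelBound N t / t) + |Real.eulerMascheroniConstant|), ?_⟩
    rintro _ ⟨n, rfl⟩
    simp only [logDiscreteLaplacian_eq hN0 hf]
    exact abs_logLaplacianSum_le hN0 hf n
  · have hlim := ENNReal.tendsto_ofReal
      ((tendsto_quotientError N).const_mul (∑ m ∈ hf.toFinset, |f m|))
    rw [mul_zero, ENNReal.ofReal_zero] at hlim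
    refine tendsto_of_tendsto_of_tendsto_of_le_of_le' tendsto_const_nhds hlim
      (Eventually.of_forall fun s => zero_le) ?_
    filter_upwards [Ioo_mem_nhdsGT (zero_lt_one (α := ℝ))] with s hs
    -- The bound is independent of `n`, so it passes to the supremum, which is taken in `ℝ≥0∞`.
    refine iSup_le fun n => ?_
    rw [logDiscreteLaplacian_eq hN0 hf, Real.enorm_eq_ofReal_abs]
    exact ENNReal.ofReal_le_ofReal (abs_quotient_sub_logLaplacianSum_le hN0 hf n hs)
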